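/- Let $f:\{-1,1\}^n\to\{-1,1\}$ have Fourier coefficients $\hat f(S)=\mathbb E_x\big[f(x)\prod_{i\in S}x_i\big]$ for $S\subseteq[n]$, where $x$ is uniform in $\{-1,1\}^n$. Write $\mathcal L_1^1(f)=\sum_{i=1}^n|\hat f(\{i\})|$ and let $\mathbb I[f]=\sum_{S\subseteq[n]}|S|\,\hat f(S)^2$ be the total influence of $f$. A width-$w$ read-once branching program on $n$ variables is a layered directed graph with $w$ nodes in each layer and a start node in the first layer. Every node outside the last layer queries one of the variables $x_1,\dots,x_n$ and has two out-edges into the next layer, labelled $-1$ and $1$. Every node of the last layer carries an output in $\{-1,1\}$. No path from the start node queries a variable twice. (Programs in which all nodes of a layer query the same variable are a special case.) On input $x$ the program follows, from the start node, the edges labelled by the values of the queried variables, and returns the output of the node reached in the last layer. Theorem. There is an absolute constant $C_0>0$, and for every integer $w\ge 2$ a constant $C_w>0$ depending only on $w$, such that for every $n\ge 1$ and every $f:\{-1,1\}^n\to\{-1,1\}$ computed by a width-$w$ read-once branching program, $$\mathcal L_1^1(f)\le (C_w\log n)^{w-2}+C_0 .$$ If moreover $f$ is monotone (nondecreasing in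 every coordinate), then $\mathbb I[f]=\mathcal L_1^1(f)$, so that $\mathbb I[f]\le (C_w\log n)^{w-2}+C_0$ as well. (Here $0^0=1$.) -/

import Mathlib

/-! ### Boolean functions and their Fourier coefficients

The set `{-1, 1}` is represented by `ℤˣ`, whose order is the one induced from `ℤ` (so `-1 < 1`). -/

/-- The discrete cube `{-1, 1}^n`, with the coordinatewise order. -/
abbrev Cube (n : ℕ) : Type := Fin n → ℤˣ

/-- A `{-1, 1}`-valued function, seen as a real-valued function. -/
def realValued {n : ℕ} (f : Cube n → ℤˣ) : Cube n → ℝ := fun x => ((f x : ℤ) : ℝ)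

/-- The Fourier coefficient of `f` on `S`: the mean of `f(x) ∏_{i ∈ S} x_i` over a uniformly
random `x` in `{-1, 1}^n`. -/
noncomputable def cubeFourierCoeff {n : ℕ} (f : Cube n → ℝ) (S : Finset (Fin n)) : ℝ :=
  (∑ x : Cube n, f x * ∏ i ∈ S, ((x i : ℤ) : ℝ)) / 2 ^ n

/-- The level `k` `ℓ₁` norm: the sum of the absolute values of the Fourier coefficients on the sets
of size `k`. -/
noncomputable def levelNorm {n : ℕ} (k : ℕ) (f : Cube n → ℝ) : ℝ :=
  ∑ S : Finset (Fin n) with S.card = k, |cubeFourierCoeff f S|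

/-- The total influence `∑_S |S| f̂(S)²`. -/
noncomputable def totalInfluence {n : ℕ} (f : Cube n → ℝ) : ℝ :=
  ∑ S : Finset (Fin n), (S.card : ℝ) * cubeFourierCoeff f S ^ 2

/-! ### Read-once branching programs -/

/-- A layered branching program of width `w` on `n` variables. It has layers `0, …, length`, each
with node set `Fin w`. Node `v` of a layer `t < length` queries the variable `query t v`, and its
out-edge labelled `b ∈ {-1, 1}` leads to the node `next t v b` of layer `t + 1`. The nodes of the
last layer carry output values. (The values of `query t` and `next t` for `t ≥ length` play no
role.) -/
structure BranchingProgram (n w : ℕ) where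
  length : ℕ
  start : Fin w
  query : ℕ → Fin w → Fin n
  next : ℕ → Fin w → ℤˣ → Fin w
  output : Fin w → ℤˣ

namespace BranchingProgram

variable {n w : ℕ}

/-- The node in layer `t` of the path from the start node that takes the out-edge labelled `b s`
in each layer `s`. -/
def pathNode (B : BranchingProgram n w) (b : ℕ → ℤˣ) : ℕ → Fin w
  | 0 => B.start
  | t + 1 => B.next t (B.pathNode b t) (b t)

/-- No path from the start node queries a variable twice. -/
def IsReadOnce (B : BranchingProgram n w) : Prop :=
  ∀ b : ℕ → ℤˣ, ∀ s t : ℕ, s < t → t < B.length →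
    B.query s (B.pathNode b s) ≠ B.query t (B.pathNode b t)

/-- The node in layer `t` reached on input `x`. -/
def inputNode (B : BranchingProgram n w) (x : Cube n) : ℕ → Fin w
  | 0 => B.start
  | t + 1 => B.next t (B.inputNode x t) (x (B.query t (B.inputNode x t)))

/-- The output on input `x`: the value carried by the node reached in the last layer. -/
def eval (B : BranchingProgram n w) (x : Cube n) : ℤˣ :=
  B.output (B.inputNode x B.length)

end BranchingProgram

/-- `f` is computed by some read-once branching program of width `w`. -/
def ComputableByROBP {n : ℕ} (w : ℕ) (f : Cube n → ℤˣ) : Prop :=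
  ∃ B : BranchingProgram n w, B.IsReadOnce ∧ ∀ x, B.eval x = f x

/-! Following the program on a random input gives a random walk on its nodes. Since no path repeats
a variable, the triangle inequality over the branches bounds the level-one norm by the expected
variation of the conditional mean output along the walk
(`BranchingProgram.IsReadOnce.fourier_nodeFrom`). This variation is bounded for every walk of at
most `n` steps, by induction on the width (`expectedVariation_le`).

For width two a potential argument suffices (`expectedVariation_add_gap_le`). For larger width,
relabelling edges so that label `1` leads to the larger mean turns the variation into a sum of
correlations with the labels, which is linear in the vector of node values. A transition whose two
labels both act as permutations then contributes nothing (`eq_of_not_collides`), so only collisions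
count. Take `2 ^ M ≥ n ^ 2`, set the last `M + 1` collisions aside and split the others into `M + 1`
residue classes. Keep one class and fix all other labels at random. Between consecutive kept
transitions lie `M` collisions, each merging two nodes with probability at least 1/2, so except with
probability `2⁻ᴹ` the walk there factors through fewer nodes. Up to a negligible error, the kept
part is thus a mixture of walks of smaller width (`sparseInfluenceVector_mem_mixedVectors`). Each
class costs the previous bound plus a constant, so one more unit of width costs a factor of order
`M`, that is `log n`.

For monotone `f`, the influence of each coordinate equals its level-one coefficient. -/

/-! ### Layered random walks -/

/-- The transition between two consecutive layers with node set `σ`: the out-edge of `v` labelled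
`b` leads to `F b v`. -/
abbrev Transition (σ : Type*) : Type _ := ℤˣ → σ → σ

section Walk

variable {σ : Type*}

/-- The mean output `φ` at the end of the walk that starts in `v` and follows uniformly random
labels. -/
noncomputable def expectedOutput (φ : σ → ℝ) : List (Transition σ) → σ → ℝ
  | [], v => φ v
  | F :: l, v => (expectedOutput φ l (F 1 v) + expectedOutput φ l (F (-1) v)) / 2

/-- The expected total variation of the mean output along the walk. -/
noncomputable def expectedVariation (φ : σ → ℝ) : List (Transition σ) → σ → ℝ
  | [], _ => 0
  | F :: l, v =>
    |(expectedOutput φ l (F 1 v) - expectedOutput φ l (F (-1) v)) / 2| +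
      (expectedVariation φ l (F 1 v) + expectedVariation φ l (F (-1) v)) / 2

/-- Averaging over the label of a transition. -/
noncomputable def averageStep (F : Transition σ) : (σ → ℝ × ℝ) →ₗ[ℝ] (σ → ℝ × ℝ) where
  toFun X v := (1 / 2 : ℝ) • (X (F 1 v) + X (F (-1) v))
  map_add' X Y := by ext v <;> simp <;> ring
  map_smul' c X := by ext v <;> simp <;> ring

/-- Averaging over the label of a transition, where the correlation of the first component with the
label is added to the second component. -/
noncomputable def influenceStep (F : Transition σ) : (σ → ℝ × ℝ) →ₗ[ℝ] (σ → ℝ × ℝ) where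
  toFun X v :=
    (((X (F 1 v)).1 + (X (F (-1) v)).1) / 2,
      ((X (F 1 v)).1 - (X (F (-1) v)).1) / 2 + ((X (F 1 v)).2 + (X (F (-1) v)).2) / 2)
  map_add' X Y := by ext v <;> simp <;> ring
  map_smul' c X := by ext v <;> simp <;> ring

theorem averageStep_apply (F : Transition σ) (X : σ → ℝ × ℝ) (v : σ) :
    averageStep F X v = (((X (F 1 v)).1 + (X (F (-1) v)).1) / 2,
      ((X (F 1 v)).2 + (X (F (-1) v)).2) / 2) := by
  ext <;> simp [averageStep] <;> ring

theorem influenceStep_apply (F : Transition σ) (X : σ → ℝ × ℝ) (v : σ) :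
    influenceStep F X v = (((X (F 1 v)).1 + (X (F (-1) v)).1) / 2,
      ((X (F 1 v)).1 - (X (F (-1) v)).1) / 2 + ((X (F 1 v)).2 + (X (F (-1) v)).2) / 2) :=
  rfl

/-- The mean output together with the sum of its correlations with the labels. -/
noncomputable def influenceVector (φ : σ → ℝ) : List (Transition σ) → σ → ℝ × ℝ
  | [] => fun v => (φ v, 0)
  | F :: l => influenceStep F (influenceVector φ l)

theorem influenceVector_fst (φ : σ → ℝ) (l : List (Transition σ)) (v : σ) :
    (influenceVector φ l v).1 = expectedOutput φ l v := by
  induction l generalizing v with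
  | nil => rfl
  | cons F l ih => simp [influenceVector, influenceStep_apply, expectedOutput, ih]

theorem abs_expectedOutput_le {φ : σ → ℝ} (hφ : ∀ v, |φ v| ≤ 1) (l : List (Transition σ)) (v : σ) :
    |expectedOutput φ l v| ≤ 1 := by
  induction l generalizing v with
  | nil => exact hφ v
  | cons F l ih =>
    have h₁ := abs_le.1 (ih (F 1 v))
    have h₂ := abs_le.1 (ih (F (-1) v))
    rw [expectedOutput, abs_le]
    constructor <;> linarith

theorem influenceVector_snd_le (φ : σ → ℝ) (l : List (Transition σ)) (v : σ) :
    (influenceVector φ l v).2 ≤ expectedVariation φ l v := by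
  induction l generalizing v with
  | nil => simp [influenceVector, expectedVariation]
  | cons F l ih =>
    have h₁ := ih (F 1 v)
    have h₂ := ih (F (-1) v)
    have h₃ := le_abs_self ((expectedOutput φ l (F 1 v) - expectedOutput φ l (F (-1) v)) / 2)
    simp only [influenceVector, influenceStep_apply, expectedVariation, influenceVector_fst]
    linarith

/-- On two nodes, the expected variation is at most the largest difference of two outputs. -/
theorem expectedVariation_add_gap_le {φ : Fin 2 → ℝ} (hφ : ∀ v, |φ v| ≤ 1)
    (l : List (Transition (Fin 2))) (v : Fin 2) :
    expectedVariation φ l v + |expectedOutput φ l 0 - expectedOutput φ l 1| ≤ 2 := by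
  induction l generalizing v with
  | nil =>
    have h₀ := abs_le.1 (hφ 0)
    have h₁ := abs_le.1 (hφ 1)
    simp only [expectedVariation, expectedOutput, zero_add]
    rw [abs_le]
    constructor <;> linarith
  | cons F l ih =>
    have h₁ := ih (F 1 v)
    have h₂ := ih (F (-1) v)
    suffices h : |(expectedOutput φ l (F 1 v) - expectedOutput φ l (F (-1) v)) / 2| +
        |expectedOutput φ (F :: l) 0 - expectedOutput φ (F :: l) 1| ≤
        |expectedOutput φ l 0 - expectedOutput φ l 1| by
      rw [expectedVariation]
      linarith
    -- If `a = b`, the first term vanishes and both averages lie between `e 0` and `e 1`. Otherwise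
    -- the first term is half the gap, and the first average is the midpoint, within half the gap of
    -- any other average.
    have key : ∀ a b c d : Fin 2, ∀ e : Fin 2 → ℝ,
        |(e a - e b) / 2| + |(e a + e b) / 2 - (e c + e d) / 2| ≤ |e 0 - e 1| := by
      intro a b c d e
      obtain rfl | ha := eq_or_ne a b
      · rw [sub_self, zero_div, abs_zero, zero_add, abs_le]
        have := neg_abs_le (e 0 - e 1)
        have := le_abs_self (e 0 - e 1)
        have := abs_nonneg (e 0 - e 1)
        fin_cases a <;> fin_cases c <;> fin_cases d <;> constructor <;> simp <;> linarith
      · have h₁ : |(e a - e b) / 2| = |e 0 - e 1| / 2 := by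
          have : |e a - e b| = |e 0 - e 1| := by
            fin_cases a <;> fin_cases b <;> simp_all [abs_sub_comm]
          rw [abs_div, this, abs_two]
        have h₂ : |(e a + e b) / 2 - (e c + e d) / 2| ≤ |e 0 - e 1| / 2 := by
          have := neg_abs_le (e 0 - e 1)
          have := le_abs_self (e 0 - e 1)
          rw [abs_le]
          fin_cases a <;> fin_cases b <;> fin_cases c <;> fin_cases d <;>
            first
            | exact absurd rfl ha
            | (constructor <;> simp <;> linarith)
        linarith
    simp only [expectedOutput]
    generalize expectedOutput φ l = e at *
    have hv : v = 0 ∨ v = 1 := by fin_cases v <;> simp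
    obtain rfl | rfl := hv
    · exact key _ _ _ _ _
    · rw [abs_sub_comm ((e (F 1 0) + e (F (-1) 0)) / 2)]
      exact key _ _ _ _ _

/-- The out-edge labelled `1` of each node leads to a mean output at least as large as the other. -/
def IsIncreasing (φ : σ → ℝ) : List (Transition σ) → Prop
  | [] => True
  | F :: l => (∀ v, expectedOutput φ l (F (-1) v) ≤ expectedOutput φ l (F 1 v)) ∧ IsIncreasing φ l

/-- Swapping the labels of out-edges makes the walk increasing, and then all correlations with the
labels are nonnegative. -/
theorem exists_isIncreasing (φ : σ → ℝ) (l : List (Transition σ)) :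
    ∃ l' : List (Transition σ), l'.length = l.length ∧ IsIncreasing φ l' ∧
      (∀ v, expectedOutput φ l' v = expectedOutput φ l v) ∧
      ∀ v, (influenceVector φ l' v).2 = expectedVariation φ l v := by
  classical
  induction l with
  | nil => exact ⟨[], rfl, trivial, fun _ => rfl, fun _ => rfl⟩
  | cons F l ih =>
    obtain ⟨l', hlen, hinc, hval, hvar⟩ := ih
    let F' : Transition σ := fun b v =>
      if expectedOutput φ l (F (-1) v) ≤ expectedOutput φ l (F 1 v) then F b v else F (-b) v
    refine ⟨F' :: l', by simp [hlen], ⟨fun v => ?_, hinc⟩, fun v => ?_, fun v => ?_⟩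
    · simp only [hval, F']
      split_ifs with h
      · exact h
      · simpa using (not_le.1 h).le
    · simp only [expectedOutput, hval, F']
      split_ifs with h
      · rfl
      · simp [add_comm]
    · simp only [influenceVector, influenceStep_apply, influenceVector_fst, expectedVariation, hval,
        hvar, F']
      split_ifs with h
      · rw [abs_of_nonneg (by linarith)]
      · rw [abs_of_nonpos (by linarith [not_le.1 h]), neg_neg]
        ring

/-! ### Collisions and sparse families of transitions -/

/-- Some label merges two nodes. -/
def Collides (F : Transition σ) : Prop := ∃ b, ¬ Function.Injective (F b)

/-- Both labels permute the nodes, so `e` has the same sum along either; a termwise inequality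
between equal sums is an equality. -/
theorem eq_of_not_collides [Finite σ] {F : Transition σ} (hF : ¬ Collides F) {e : σ → ℝ}
    (he : ∀ v, e (F (-1) v) ≤ e (F 1 v)) (v : σ) : e (F 1 v) = e (F (-1) v) := by
  have := Fintype.ofFinite σ
  simp only [Collides, not_exists, not_not] at hF
  have hsum : ∀ b, ∑ v, e (F b v) = ∑ v, e v := fun b =>
    (Equiv.ofBijective (F b) (Finite.injective_iff_bijective.1 (hF b))).sum_comp e
  exact ((Finset.sum_eq_sum_iff_of_le fun v _ => he v).1 ((hsum _).trans (hsum _).symm) v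
    (Finset.mem_univ v)).symm

open Classical in
/-- The number of transitions with a collision. -/
noncomputable def collisionCount : List (Transition σ) → ℕ
  | [] => 0
  | F :: l => if Collides F then collisionCount l + 1 else collisionCount l

open Classical in
/-- As `influenceVector`, but correlations are collected only at transitions with a collision such
that the number of later ones is at least `m` and congruent to `r` modulo `m`. -/
noncomputable def sparseInfluenceVector (φ : σ → ℝ) (m r : ℕ) : List (Transition σ) → σ → ℝ × ℝ
  | [] => fun v => (φ v, 0)
  | F :: l =>
    if Collides F ∧ m ≤ collisionCount l ∧ collisionCount l % m = r then
      influenceStep F (sparseInfluenceVector φ m r l)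
    else averageStep F (sparseInfluenceVector φ m r l)

theorem sparseInfluenceVector_fst (φ : σ → ℝ) (m r : ℕ) (l : List (Transition σ)) (v : σ) :
    (sparseInfluenceVector φ m r l v).1 = expectedOutput φ l v := by
  induction l generalizing v with
  | nil => rfl
  | cons F l ih =>
    rw [sparseInfluenceVector]
    split_ifs <;> simp [influenceStep_apply, averageStep_apply, expectedOutput, ih]

theorem collisionCount_le_length (l : List (Transition σ)) : collisionCount l ≤ l.length := by
  induction l with
  | nil => simp [collisionCount]
  | cons F l ih =>
    rw [collisionCount, List.length_cons]
    split_ifs <;> omega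

-- A collision with at least `m` later ones is collected for exactly one residue. Each of the last
-- `m` collisions costs at most 1, as half a difference of means in `[-1, 1]`.
open Classical in
theorem influenceVector_snd_le_sum [Finite σ] {φ : σ → ℝ} (hφ : ∀ v, |φ v| ≤ 1) {m : ℕ}
    (hm : 0 < m) {l : List (Transition σ)} (hl : IsIncreasing φ l) (v : σ) :
    (influenceVector φ l v).2 ≤
      ∑ r ∈ Finset.range m, (sparseInfluenceVector φ m r l v).2 +
        ((min (collisionCount l) m : ℕ) : ℝ) := by
  induction l generalizing v with
  | nil => simp [influenceVector, sparseInfluenceVector]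
  | cons F l ih =>
    have h₁ := ih hl.2 (F 1 v)
    have h₂ := ih hl.2 (F (-1) v)
    have e₁ := abs_le.1 (abs_expectedOutput_le hφ l (F 1 v))
    have e₂ := abs_le.1 (abs_expectedOutput_le hφ l (F (-1) v))
    set D : ℝ := (expectedOutput φ l (F 1 v) - expectedOutput φ l (F (-1) v)) / 2 with hD
    have hstep : ∀ r, (sparseInfluenceVector φ m r (F :: l) v).2 =
        (if Collides F ∧ m ≤ collisionCount l ∧ collisionCount l % m = r then D else 0) +
        ((sparseInfluenceVector φ m r l (F 1 v)).2 +
          (sparseInfluenceVector φ m r l (F (-1) v)).2) / 2 := by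
      intro r
      rw [sparseInfluenceVector]
      split_ifs <;> simp [influenceStep_apply, averageStep_apply, sparseInfluenceVector_fst, hD]
    have hlhs : (influenceVector φ (F :: l) v).2 =
        D + ((influenceVector φ l (F 1 v)).2 + (influenceVector φ l (F (-1) v)).2) / 2 := by
      simp [influenceVector, influenceStep_apply, influenceVector_fst, hD]
    have hcost : D + ((min (collisionCount l) m : ℕ) : ℝ) ≤
        ∑ r ∈ Finset.range m,
          (if Collides F ∧ m ≤ collisionCount l ∧ collisionCount l % m = r then D else 0) +
        ((min (collisionCount (F :: l)) m : ℕ) : ℝ) := by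
      rw [collisionCount]
      by_cases hF : Collides F
      · by_cases hc : m ≤ collisionCount l
        · rw [if_pos hF, min_eq_right hc, min_eq_right (hc.trans (Nat.le_succ _))]
          simp [hF, hc, Nat.mod_lt _ hm]
        · rw [if_pos hF, min_eq_left (by omega), min_eq_left (by omega)]
          simp [hc]
          linarith
      · have : D = 0 := by
          rw [hD, eq_of_not_collides hF hl.1 v, sub_self, zero_div]
        simp [hF, this]
    rw [hlhs, Finset.sum_congr rfl fun r _ => hstep r, Finset.sum_add_distrib, ← Finset.sum_div,
      Finset.sum_add_distrib]
    linarith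

end Walk

open scoped Pointwise

/-! ### Restricting all but few transitions -/

section Restriction

variable {σ : Type*}

/-- Pairs of functions of which the first is bounded by `δ` and the second by `k * δ`. -/
def boundedVectors (σ : Type*) (k : ℕ) (δ : ℝ) : Set (σ → ℝ × ℝ) :=
  {E | ∀ v, |(E v).1| ≤ δ ∧ |(E v).2| ≤ k * δ}

theorem convex_boundedVectors (k : ℕ) (δ : ℝ) : Convex ℝ (boundedVectors σ k δ) := by
  intro X hX Y hY a b ha hb hab v
  obtain ⟨h₁, h₂⟩ := hX v
  obtain ⟨h₃, h₄⟩ := hY v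
  have key : ∀ x y c : ℝ, |x| ≤ c → |y| ≤ c → |a * x + b * y| ≤ c := by
    intro x y c hx hy
    calc |a * x + b * y| ≤ a * |x| + b * |y| := by
          refine (abs_add_le _ _).trans_eq ?_
          rw [abs_mul, abs_mul, abs_of_nonneg ha, abs_of_nonneg hb]
      _ ≤ a * c + b * c := by gcongr
      _ = c := by rw [← add_mul, hab, one_mul]
  exact ⟨by simpa using key _ _ _ h₁ h₃, by simpa using key _ _ _ h₂ h₄⟩

theorem averageStep_mem_boundedVectors {k : ℕ} {δ : ℝ} {E : σ → ℝ × ℝ}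
    (hE : E ∈ boundedVectors σ k δ) (F : Transition σ) :
    averageStep F E ∈ boundedVectors σ k δ := by
  intro v
  obtain ⟨h₁, h₂⟩ := hE (F 1 v)
  obtain ⟨h₃, h₄⟩ := hE (F (-1) v)
  rw [abs_le] at h₁ h₂ h₃ h₄
  rw [averageStep_apply, abs_le, abs_le]
  refine ⟨⟨?_, ?_⟩, ?_, ?_⟩ <;> simp only <;> linarith

theorem influenceStep_mem_boundedVectors {k : ℕ} {δ : ℝ} {E : σ → ℝ × ℝ}
    (hE : E ∈ boundedVectors σ k δ) (F : Transition σ) :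
    influenceStep F E ∈ boundedVectors σ (k + 1) δ := by
  intro v
  obtain ⟨h₁, h₂⟩ := hE (F 1 v)
  obtain ⟨h₃, h₄⟩ := hE (F (-1) v)
  rw [abs_le] at h₁ h₂ h₃ h₄
  rw [influenceStep_apply, abs_le, abs_le]
  push_cast
  refine ⟨⟨?_, ?_⟩, ?_, ?_⟩ <;> linarith

theorem smul_add_smul_mem_boundedVectors {k : ℕ} {a b δ : ℝ} (ha : 0 ≤ a) {E E' : σ → ℝ × ℝ}
    (hE : E ∈ boundedVectors σ k 1) (hE' : E' ∈ boundedVectors σ k b) (h : a + b ≤ δ) :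
    a • E + E' ∈ boundedVectors σ k δ := by
  intro v
  obtain ⟨h₁, h₂⟩ := hE v
  obtain ⟨h₃, h₄⟩ := hE' v
  have key : ∀ x y c : ℝ, |x| ≤ c * 1 → |y| ≤ c * b → 0 ≤ c → |a * x + y| ≤ c * δ := by
    intro x y c hx hy hc
    calc |a * x + y| ≤ a * |x| + |y| := by
          refine (abs_add_le _ _).trans_eq ?_
          rw [abs_mul, abs_of_nonneg ha]
      _ ≤ a * (c * 1) + c * b := by gcongr
      _ = c * (a + b) := by ring
      _ ≤ c * δ := by gcongr
  refine ⟨?_, ?_⟩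
  · simpa using key (E v).1 (E' v).1 1 (by simpa using h₁) (by simpa using h₃) zero_le_one
  · simpa using key (E v).2 (E' v).2 k h₂ h₄ k.cast_nonneg

theorem influenceVector_mem_boundedVectors {φ : σ → ℝ} (hφ : ∀ v, |φ v| ≤ 1)
    (l : List (Transition σ)) : influenceVector φ l ∈ boundedVectors σ l.length 1 := by
  induction l with
  | nil => exact fun v => by simpa [influenceVector] using hφ v
  | cons F l ih => exact influenceStep_mem_boundedVectors ih F

/-- The vectors that come from walks of at most `k` steps on `τ`. -/
def walkVectors (σ τ : Type*) (k : ℕ) : Set (σ → ℝ × ℝ) :=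
  {X | ∃ (l : List (Transition τ)) (φ : τ → ℝ) (π : σ → τ), l.length ≤ k ∧ (∀ u, |φ u| ≤ 1) ∧
    X = influenceVector φ l ∘ π}

variable {τ : Type*}

/-- Precomposition only changes the map `π` that chooses the starting node. -/
theorem comp_mem_convexHull_walkVectors {k : ℕ} {X : σ → ℝ × ℝ}
    (hX : X ∈ convexHull ℝ (walkVectors σ τ k)) (G : σ → σ) :
    X ∘ G ∈ convexHull ℝ (walkVectors σ τ k) := by
  have hsub : walkVectors σ τ k ⊆
      LinearMap.funLeft ℝ (ℝ × ℝ) G ⁻¹' convexHull ℝ (walkVectors σ τ k) := by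
    rintro _ ⟨l, φ, π, hl, hφ, rfl⟩
    exact subset_convexHull ℝ _ ⟨l, φ, π ∘ G, hl, hφ, rfl⟩
  exact convexHull_min hsub ((convex_convexHull ℝ _).linear_preimage _) hX

theorem convexHull_walkVectors_subset (k : ℕ) :
    convexHull ℝ (walkVectors σ τ k) ⊆ boundedVectors σ k 1 := by
  refine convexHull_min ?_ (convex_boundedVectors k 1)
  rintro _ ⟨l, φ, π, hl, hφ, rfl⟩ v
  obtain ⟨h₁, h₂⟩ := influenceVector_mem_boundedVectors hφ l (π v)
  exact ⟨h₁, h₂.trans (by gcongr)⟩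

theorem snd_le_of_mem_convexHull_walkVectors {k : ℕ} {S : ℝ}
    (hS : ∀ l : List (Transition τ), l.length ≤ k → ∀ φ : τ → ℝ, (∀ u, |φ u| ≤ 1) →
      ∀ u, expectedVariation φ l u ≤ S)
    {X : σ → ℝ × ℝ} (hX : X ∈ convexHull ℝ (walkVectors σ τ k)) (v : σ) : (X v).2 ≤ S := by
  have hsub : walkVectors σ τ k ⊆ {X | (X v).2 ≤ S} := by
    rintro _ ⟨l, φ, π, hl, hφ, rfl⟩
    exact (influenceVector_snd_le φ l (π v)).trans (hS l hl φ hφ (π v))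
  have hconv : Convex ℝ {X : σ → ℝ × ℝ | (X v).2 ≤ S} :=
    convex_halfSpace_le (f := fun X : σ → ℝ × ℝ => (X v).2)
      ⟨fun _ _ => rfl, fun _ _ => rfl⟩ S
  exact convexHull_min hsub hconv hX

theorem zero_mem_convexHull_walkVectors [Nonempty τ] (k : ℕ) :
    (0 : σ → ℝ × ℝ) ∈ convexHull ℝ (walkVectors σ τ k) := by
  refine subset_convexHull ℝ _ ⟨[], 0, fun _ => Classical.arbitrary τ, Nat.zero_le k, by simp, ?_⟩
  rfl

theorem averageStep_eq (F : Transition σ) (X : σ → ℝ × ℝ) :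
    averageStep F X = (1 / 2 : ℝ) • (X ∘ F 1) + (1 / 2 : ℝ) • (X ∘ F (-1)) :=
  funext fun v => smul_add (1 / 2 : ℝ) (X (F 1 v)) (X (F (-1) v))

theorem averageStep_mem_smul_convexHull_walkVectors {k : ℕ} {c : ℝ} {X : σ → ℝ × ℝ}
    (hX : X ∈ c • convexHull ℝ (walkVectors σ τ k)) (F : Transition σ) :
    averageStep F X ∈ c • convexHull ℝ (walkVectors σ τ k) := by
  obtain ⟨Y, hY, rfl⟩ := hX
  refine ⟨averageStep F Y, ?_, ((averageStep F).map_smul c Y).symm⟩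
  rw [averageStep_eq]
  exact convex_convexHull ℝ _ (comp_mem_convexHull_walkVectors hY _)
    (comp_mem_convexHull_walkVectors hY _) (by norm_num) (by norm_num) (by norm_num)

/-- A map that merges two nodes factors through a smaller node set. -/
theorem exists_factorization {w : ℕ} {G : Fin (w + 2) → Fin (w + 2)} (hG : ¬ Function.Injective G) :
    ∃ (π : Fin (w + 2) → Fin (w + 1)) (ι : Fin (w + 1) → Fin (w + 2)), G = ι ∘ π := by
  classical
  have hcard : Fintype.card (Set.range G) ≤ Fintype.card (Fin (w + 1)) := by
    have hlt : Fintype.card (Set.range G) < Fintype.card (Fin (w + 2)) := by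
      refine lt_of_le_of_ne (Fintype.card_range_le G) fun h => hG ?_
      have hbij := (Set.rangeFactorization_surjective (f := G)).bijective_of_nat_card_le
        (by rw [Nat.card_eq_fintype_card, Nat.card_eq_fintype_card, h])
      exact fun a b hab => hbij.1 (Subtype.ext hab)
    rw [Fintype.card_fin] at hlt ⊢
    exact Nat.le_of_lt_succ hlt
  obtain ⟨e⟩ := Function.Embedding.nonempty_of_card_le hcard
  refine ⟨fun v => e ⟨G v, v, rfl⟩, fun u => (Function.invFun e u : Set.range G), ?_⟩
  have : Nonempty (Set.range G) := ⟨⟨G 0, 0, rfl⟩⟩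
  funext v
  simp [Function.leftInverse_invFun e.injective _]

/-- After `G` at most `w + 1` nodes are occupied, so the step is a transition of a narrower walk:
lift by `ι`, move by `F`, and project to the narrower walk that follows. -/
theorem influenceStep_comp_mem {w k : ℕ} {X : Fin (w + 2) → ℝ × ℝ}
    (hX : X ∈ convexHull ℝ (walkVectors (Fin (w + 2)) (Fin (w + 1)) k))
    (F : Transition (Fin (w + 2))) {G : Fin (w + 2) → Fin (w + 2)} (hG : ¬ Function.Injective G) :
    influenceStep F X ∘ G ∈ convexHull ℝ (walkVectors (Fin (w + 2)) (Fin (w + 1)) (k + 1)) := by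
  obtain ⟨π, ι, rfl⟩ := exists_factorization hG
  have hsub : walkVectors (Fin (w + 2)) (Fin (w + 1)) k ⊆
      ((LinearMap.funLeft ℝ (ℝ × ℝ) (ι ∘ π)).comp (influenceStep F)) ⁻¹'
        convexHull ℝ (walkVectors (Fin (w + 2)) (Fin (w + 1)) (k + 1)) := by
    rintro _ ⟨l, φ, ρ, hl, hφ, rfl⟩
    exact subset_convexHull ℝ _ ⟨(fun b u => ρ (F b (ι u))) :: l, φ, π, by simpa using hl, hφ, rfl⟩
  exact convexHull_min hsub ((convex_convexHull ℝ _).linear_preimage _) hX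

/-! ### Mixtures with a small unmerged part -/

/-- The vectors that become convex combinations of vectors of narrower walks as soon as two nodes
are merged. -/
def mergeableVectors (σ τ : Type*) (k : ℕ) (S : ℝ) : Set (σ → ℝ × ℝ) :=
  {A | A ∈ boundedVectors σ k 1 ∧ (∀ v, (A v).2 ≤ S) ∧
    ∀ G : σ → σ, ¬ Function.Injective G → A ∘ G ∈ convexHull ℝ (walkVectors σ τ k)}

theorem comp_mem_mergeableVectors {k : ℕ} {S : ℝ} {A : σ → ℝ × ℝ}
    (hA : A ∈ mergeableVectors σ τ k S) (G : σ → σ) : A ∘ G ∈ mergeableVectors σ τ k S :=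
  ⟨fun v => hA.1 (G v), fun v => hA.2.1 (G v),
    fun G' hG' => hA.2.2 (G ∘ G') fun h => hG' h.of_comp⟩

theorem averageStep_mem_mergeableVectors {k : ℕ} {S : ℝ} {A : σ → ℝ × ℝ}
    (hA : A ∈ mergeableVectors σ τ k S) (F : Transition σ) :
    averageStep F A ∈ mergeableVectors σ τ k S := by
  refine ⟨averageStep_mem_boundedVectors hA.1 F, fun v => ?_, fun G hG => ?_⟩
  · have h₁ := hA.2.1 (F 1 v)
    have h₂ := hA.2.1 (F (-1) v)
    rw [averageStep_apply]
    simp only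
    linarith
  · rw [averageStep_eq]
    exact convex_convexHull ℝ _ ((comp_mem_mergeableVectors hA (F 1)).2.2 G hG)
      ((comp_mem_mergeableVectors hA (F (-1))).2.2 G hG)
      (by norm_num) (by norm_num) (by norm_num)

/-- The vectors that are, up to an error of order `k * ε`, mixtures of a mergeable vector of weight
`2⁻ʲ` and of vectors of narrower walks. -/
def mixedVectors (σ τ : Type*) (S ε : ℝ) (k j : ℕ) : Set (σ → ℝ × ℝ) :=
  {X | ∃ Y A E : σ → ℝ × ℝ, Y ∈ (1 - (1 / 2) ^ j : ℝ) • convexHull ℝ (walkVectors σ τ k) ∧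
    A ∈ mergeableVectors σ τ k S ∧ E ∈ boundedVectors σ k (k * ε) ∧
    X = Y + (1 / 2 : ℝ) ^ j • A + E}

theorem one_sub_half_pow_nonneg (j : ℕ) : (0 : ℝ) ≤ 1 - (1 / 2) ^ j :=
  sub_nonneg.2 (pow_le_one₀ (by norm_num) (by norm_num))

theorem averageStep_mem_mixedVectors {S ε : ℝ} {k j : ℕ} {X : σ → ℝ × ℝ}
    (hX : X ∈ mixedVectors σ τ S ε k j) (F : Transition σ) :
    averageStep F X ∈ mixedVectors σ τ S ε k j := by
  obtain ⟨Y, A, E, hY, hA, hE, rfl⟩ := hX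
  exact ⟨_, _, _, averageStep_mem_smul_convexHull_walkVectors hY F,
    averageStep_mem_mergeableVectors hA F, averageStep_mem_boundedVectors hE F, by simp⟩

/-- The merging label has probability 1/2: it turns half of the mergeable weight into narrower
walks, and the other half stays mergeable. -/
theorem averageStep_mem_mixedVectors_of_collides {S ε : ℝ} {k j : ℕ} {X : σ → ℝ × ℝ}
    (hX : X ∈ mixedVectors σ τ S ε k j) {F : Transition σ} (hF : Collides F) :
    averageStep F X ∈ mixedVectors σ τ S ε k (j + 1) := by
  obtain ⟨Y, A, E, hY, hA, hE, rfl⟩ := hX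
  obtain ⟨b, hb⟩ := hF
  refine ⟨averageStep F Y + (1 / 2 : ℝ) ^ (j + 1) • (A ∘ F b), A ∘ F (-b), _, ?_,
    comp_mem_mergeableVectors hA _, averageStep_mem_boundedVectors hE F, ?_⟩
  · have : (1 - (1 / 2) ^ (j + 1) : ℝ) = (1 - (1 / 2) ^ j) + (1 / 2) ^ (j + 1) := by ring
    rw [this, (convex_convexHull ℝ _).add_smul (one_sub_half_pow_nonneg j) (by positivity)]
    exact Set.add_mem_add (averageStep_mem_smul_convexHull_walkVectors hY F)
      (Set.smul_mem_smul_set (hA.2.2 _ hb))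
  · have hAF : averageStep F A = (1 / 2 : ℝ) • (A ∘ F b) + (1 / 2 : ℝ) • (A ∘ F (-b)) := by
      rw [averageStep_eq]
      obtain rfl | rfl := Int.units_eq_one_or b
      · rfl
      · rw [neg_neg, add_comm]
    rw [map_add, map_add, map_smul, hAF, pow_succ]
    module

/-- The narrow part `Y` becomes the new mergeable vector, whose bound is `S + 1` because the step
adds a correlation of at most 1. The unmerged remainder, of weight at most `ε`, joins the error, and
`j` restarts at 0. -/
theorem influenceStep_mem_mixedVectors {w : ℕ} {S ε : ℝ} {k j : ℕ}
    (hS : ∀ l : List (Transition (Fin (w + 1))), l.length ≤ k → ∀ φ : Fin (w + 1) → ℝ,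
      (∀ u, |φ u| ≤ 1) → ∀ u, expectedVariation φ l u ≤ S)
    (hj : (1 / 2) ^ j ≤ ε) {X : Fin (w + 2) → ℝ × ℝ}
    (hX : X ∈ mixedVectors (Fin (w + 2)) (Fin (w + 1)) (S + 1) ε k j)
    (F : Transition (Fin (w + 2))) :
    influenceStep F X ∈ mixedVectors (Fin (w + 2)) (Fin (w + 1)) (S + 1) ε (k + 1) 0 := by
  obtain ⟨Y, A, E, hY, hA, hE, rfl⟩ := hX
  -- The missing weight `2⁻ʲ` is given to the zero vector.
  have hY' : Y ∈ convexHull ℝ (walkVectors (Fin (w + 2)) (Fin (w + 1)) k) := by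
    obtain ⟨Z, hZ, rfl⟩ := hY
    exact (convex_convexHull ℝ _).smul_mem_of_zero_mem (zero_mem_convexHull_walkVectors k) hZ
      ⟨one_sub_half_pow_nonneg j, sub_le_self _ (by positivity)⟩
  refine ⟨0, influenceStep F Y, influenceStep F ((1 / 2 : ℝ) ^ j • A + E), ?_, ⟨?_, ?_, ?_⟩, ?_, ?_⟩
  · exact ⟨0, zero_mem_convexHull_walkVectors _, smul_zero _⟩
  · exact influenceStep_mem_boundedVectors (convexHull_walkVectors_subset k hY') F
  · intro v
    have h₁ := snd_le_of_mem_convexHull_walkVectors hS hY' (F 1 v)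
    have h₂ := snd_le_of_mem_convexHull_walkVectors hS hY' (F (-1) v)
    have h₃ := abs_le.1 (convexHull_walkVectors_subset k hY' (F 1 v)).1
    have h₄ := abs_le.1 (convexHull_walkVectors_subset k hY' (F (-1) v)).1
    rw [influenceStep_apply]
    simp only
    linarith
  · exact fun G hG => influenceStep_comp_mem hY' F hG
  -- The error grows to `2⁻ʲ + k * ε ≤ (k + 1) * ε`.
  · refine influenceStep_mem_boundedVectors
      (smul_add_smul_mem_boundedVectors (by positivity) hA.1 hE ?_) F
    push_cast
    linarith
  · simp [add_assoc]

theorem snd_le_of_mem_mixedVectors {S ε : ℝ} {k j : ℕ}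
    (hS : ∀ l : List (Transition τ), l.length ≤ k → ∀ φ : τ → ℝ, (∀ u, |φ u| ≤ 1) →
      ∀ u, expectedVariation φ l u ≤ S) {X : σ → ℝ × ℝ}
    (hX : X ∈ mixedVectors σ τ (S + 1) ε k j) (v : σ) : (X v).2 ≤ S + 1 + k ^ 2 * ε := by
  obtain ⟨_, A, E, ⟨Z, hZ, rfl⟩, hA, hE, rfl⟩ := hX
  have h₁ := snd_le_of_mem_convexHull_walkVectors hS hZ v
  have h₂ := hA.2.1 v
  have h₃ := (abs_le.1 (hE v).2).2
  have hp := one_sub_half_pow_nonneg j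
  have hq : (0 : ℝ) ≤ (1 / 2) ^ j := by positivity
  have h₄ := mul_le_mul_of_nonneg_left (h₁.trans (le_add_of_nonneg_right zero_le_one)) hp
  have h₅ := mul_le_mul_of_nonneg_left h₂ hq
  simp only [Pi.add_apply, Pi.smul_apply, Prod.snd_add, Prod.smul_snd, smul_eq_mul]
  nlinarith

/-- In the induction from the end of the walk, `k` counts the collected transitions and `j` the
collisions since the last collected one. The middle clause ensures that `j` is at least `M` by the
time a transition with `c` later collisions is collected, so the unmerged weight is then at most
`2⁻ᴹ`. -/
theorem sparseInfluenceVector_mem_mixedVectors {w M : ℕ} {S : ℝ} {n : ℕ}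
    (hS₀ : 0 ≤ S)
    (hS : ∀ l : List (Transition (Fin (w + 1))), l.length ≤ n → ∀ φ : Fin (w + 1) → ℝ,
      (∀ u, |φ u| ≤ 1) → ∀ u, expectedVariation φ l u ≤ S)
    {φ : Fin (w + 2) → ℝ} (hφ : ∀ v, |φ v| ≤ 1) (r : ℕ) (l : List (Transition (Fin (w + 2))))
    (hl : l.length ≤ n) :
    ∃ k j : ℕ, k ≤ collisionCount l ∧
      (∀ c, collisionCount l ≤ c → M + 1 ≤ c → c % (M + 1) = r → M + collisionCount l ≤ j + c) ∧
      sparseInfluenceVector φ (M + 1) r l ∈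
        mixedVectors (Fin (w + 2)) (Fin (w + 1)) (S + 1) ((1 / 2) ^ M) k j := by
  induction l with
  | nil =>
    refine ⟨0, 0, le_rfl, fun c _ hc _ => by simp [collisionCount]; omega, 0, _, 0,
      ⟨0, zero_mem_convexHull_walkVectors _, smul_zero _⟩, ⟨?_, ?_, ?_⟩, ?_,
      (show sparseInfluenceVector φ (M + 1) r [] = _ by simp; rfl)⟩
    · exact fun v => by simpa [sparseInfluenceVector] using hφ v
    · intro v
      simp only [sparseInfluenceVector]
      linarith
    · intro G hG
      obtain ⟨π, ι, rfl⟩ := exists_factorization hG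
      exact subset_convexHull ℝ _ ⟨[], φ ∘ ι, π, le_rfl, fun u => hφ _, rfl⟩
    · exact fun v => by simp
  | cons F l ih =>
    have hlen : l.length ≤ n := (Nat.le_succ _).trans hl
    obtain ⟨k, j, hk, hj, hX⟩ := ih hlen
    have hkn : k ≤ n := hk.trans ((collisionCount_le_length l).trans hlen)
    rw [sparseInfluenceVector, collisionCount]
    split_ifs with hF hF' hF'
    · refine ⟨k + 1, 0, by omega, fun c h₁ h₂ h₃ => ?_,
        influenceStep_mem_mixedVectors (fun l hl => hS l (hl.trans hkn)) ?_ hX F⟩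
      -- Distinct counts in one class differ by at least `M + 1`, which leaves room for `M`
      -- collisions in between.
      · have hmod : collisionCount l ≡ c [MOD (M + 1)] := hF'.2.2.trans h₃.symm
        have := Nat.le_of_dvd (by omega) ((Nat.modEq_iff_dvd' (by omega)).1 hmod)
        omega
      -- Taking `c` to be the present count gives `M ≤ j`.
      · have := hj _ le_rfl hF'.2.1 hF'.2.2
        exact pow_le_pow_of_le_one (by norm_num) (by norm_num) (by omega)
    · refine ⟨k, j + 1, by omega, fun c h₁ h₂ h₃ => ?_,
        averageStep_mem_mixedVectors_of_collides hX hF⟩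
      have := hj c (by omega) h₂ h₃
      omega
    · exact absurd hF'.1 hF
    · exact ⟨k, j, hk, hj, averageStep_mem_mixedVectors hX F⟩

/-! ### Induction on the width -/

/-- Bound on the expected variation of a walk on `w + 2` nodes. -/
theorem expectedVariation_le {n M : ℕ} (hM : n ^ 2 ≤ 2 ^ M) (w : ℕ)
    (l : List (Transition (Fin (w + 2)))) (hl : l.length ≤ n) (φ : Fin (w + 2) → ℝ)
    (hφ : ∀ v, |φ v| ≤ 1) (v : Fin (w + 2)) :
    expectedVariation φ l v ≤ 5 * (M + 2 : ℝ) ^ w - 3 := by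
  induction w with
  | zero =>
    have := expectedVariation_add_gap_le hφ l v
    have := abs_nonneg (expectedOutput φ l 0 - expectedOutput φ l 1)
    simp only [pow_zero]
    linarith
  | succ w ih =>
    set S : ℝ := 5 * (M + 2 : ℝ) ^ w - 3 with hSdef
    have hpow : (1 : ℝ) ≤ (M + 2 : ℝ) ^ w := one_le_pow₀ (by linarith [M.cast_nonneg (α := ℝ)])
    have hS₀ : 0 ≤ S := by linarith
    obtain ⟨l', hlen, hinc, -, hvar⟩ := exists_isIncreasing φ l
    have hr : ∀ r, (sparseInfluenceVector φ (M + 1) r l' v).2 ≤ S + 2 := by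
      intro r
      obtain ⟨k, j, hk, -, hX⟩ :=
        sparseInfluenceVector_mem_mixedVectors (M := M) hS₀ ih hφ r l' (hlen.trans_le hl)
      have hkn : k ≤ n := hk.trans ((collisionCount_le_length l').trans (hlen.trans_le hl))
      have h := snd_le_of_mem_mixedVectors (fun l hl => ih l (hl.trans hkn)) hX v
      have : (k : ℝ) ^ 2 * (1 / 2) ^ M ≤ 1 := by
        rw [one_div, inv_pow, ← div_eq_mul_inv, div_le_one (by positivity)]
        exact_mod_cast (Nat.pow_le_pow_left hkn 2).trans hM
      linarith
    have hsum := influenceVector_snd_le_sum hφ (Nat.succ_pos M) hinc v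
    have h₁ : ∑ r ∈ Finset.range (M + 1), (sparseInfluenceVector φ (M + 1) r l' v).2 ≤
        (M + 1) * (S + 2) := by
      refine (Finset.sum_le_sum fun r _ => hr r).trans_eq ?_
      simp
      ring
    have h₂ : ((min (collisionCount l') (M + 1) : ℕ) : ℝ) ≤ M + 1 := by
      exact_mod_cast min_le_right _ _
    -- The total is at most `(M + 1) * (S + 3)`, which is `5 * (M + 2) ^ (w + 1) - 5 * (M + 2) ^ w`;
    -- the offset `-3` absorbs the additive losses.
    rw [← hvar, pow_succ]
    have hM₀ := M.cast_nonneg (α := ℝ)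
    rw [Nat.succ_eq_add_one] at hsum
    nlinarith

end Restriction

/-! ### Fourier coefficients of level one -/

section Fourier

variable {n : ℕ}

/-- The function `g` on the cube does not depend on the coordinate `i`. -/
def IgnoresCoord {α : Type*} (g : Cube n → α) (i : Fin n) : Prop :=
  ∀ x c, g (Function.update x i c) = g x

/-- Negation of the coordinate `i`. -/
def flipCoord (i : Fin n) (x : Cube n) : Cube n := Function.update x i (-x i)

theorem flipCoord_involutive (i : Fin n) : Function.Involutive (flipCoord i) := by
  intro x
  simp [flipCoord]

theorem sum_flipCoord (i : Fin n) (g : Cube n → ℝ) : ∑ x, g (flipCoord i x) = ∑ x, g x :=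
  Equiv.sum_comp (flipCoord_involutive i).toPerm g

theorem sum_mul_coord_eq_zero {g : Cube n → ℝ} {i : Fin n} (hg : IgnoresCoord g i) :
    ∑ x : Cube n, g x * ((x i : ℤ) : ℝ) = 0 := by
  have h := sum_flipCoord i fun x => g x * ((x i : ℤ) : ℝ)
  simp only [flipCoord, hg _ _, Function.update_self, Units.val_neg, Int.cast_neg, mul_neg,
    Finset.sum_neg_distrib] at h
  linarith

theorem cubeFourierCoeff_singleton (g : Cube n → ℝ) (i : Fin n) :
    cubeFourierCoeff g {i} = (∑ x : Cube n, g x * ((x i : ℤ) : ℝ)) / 2 ^ n := by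
  simp [cubeFourierCoeff]

theorem cubeFourierCoeff_empty (g : Cube n → ℝ) :
    cubeFourierCoeff g ∅ = (∑ x : Cube n, g x) / 2 ^ n := by
  simp [cubeFourierCoeff]

theorem levelNorm_one (g : Cube n → ℝ) : levelNorm 1 g = ∑ i, |cubeFourierCoeff g {i}| := by
  have : (Finset.univ.filter fun S : Finset (Fin n) => S.card = 1) =
      Finset.univ.map ⟨_, Finset.singleton_injective⟩ := by
    ext S
    simp [Finset.card_eq_one, eq_comm]
  rw [levelNorm, this, Finset.sum_map]
  rfl

theorem coord_sq (x : Cube n) (i : Fin n) : ((x i : ℤ) : ℝ) * ((x i : ℤ) : ℝ) = 1 := by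
  obtain h | h := Int.units_eq_one_or (x i) <;> simp [h]

/-- The values of a function that branches on the coordinate `i`. -/
theorem branch_eq (G : ℤˣ → Cube n → ℝ) (i : Fin n) (x : Cube n) :
    G (x i) x = (G 1 x + G (-1) x) / 2 + (G 1 x - G (-1) x) / 2 * ((x i : ℤ) : ℝ) := by
  obtain h | h := Int.units_eq_one_or (x i) <;> simp [h] <;> ring

theorem cubeFourierCoeff_branch_empty {G : ℤˣ → Cube n → ℝ} {i : Fin n}
    (hG : ∀ b, IgnoresCoord (G b) i) :
    cubeFourierCoeff (fun x => G (x i) x) ∅ =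
      (cubeFourierCoeff (G 1) ∅ + cubeFourierCoeff (G (-1)) ∅) / 2 := by
  have h : ∑ x : Cube n, (G 1 x - G (-1) x) / 2 * ((x i : ℤ) : ℝ) = 0 :=
    sum_mul_coord_eq_zero fun x c => by rw [hG, hG]
  simp only [cubeFourierCoeff_empty]
  simp only [branch_eq G i, Finset.sum_add_distrib, h, ← Finset.sum_div]
  ring

theorem cubeFourierCoeff_branch_self {G : ℤˣ → Cube n → ℝ} {i : Fin n}
    (hG : ∀ b, IgnoresCoord (G b) i) :
    cubeFourierCoeff (fun x => G (x i) x) {i} =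
      (cubeFourierCoeff (G 1) ∅ - cubeFourierCoeff (G (-1)) ∅) / 2 := by
  have h : ∑ x : Cube n, (G 1 x + G (-1) x) / 2 * ((x i : ℤ) : ℝ) = 0 :=
    sum_mul_coord_eq_zero fun x c => by rw [hG, hG]
  simp only [cubeFourierCoeff_empty, cubeFourierCoeff_singleton]
  simp only [branch_eq G i, add_mul, mul_assoc, coord_sq, mul_one, Finset.sum_add_distrib, h,
    ← Finset.sum_div, Finset.sum_sub_distrib]
  ring

theorem cubeFourierCoeff_branch_of_ne {G : ℤˣ → Cube n → ℝ} {i j : Fin n}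
    (hG : ∀ b, IgnoresCoord (G b) i) (hij : j ≠ i) :
    cubeFourierCoeff (fun x => G (x i) x) {j} =
      (cubeFourierCoeff (G 1) {j} + cubeFourierCoeff (G (-1)) {j}) / 2 := by
  -- The factor `x i` is put last so that the rest, including `x j`, ignores the coordinate `i`.
  have h : ∑ x : Cube n, (G 1 x - G (-1) x) / 2 * ((x j : ℤ) : ℝ) * ((x i : ℤ) : ℝ) = 0 :=
    sum_mul_coord_eq_zero fun x c => by rw [hG, hG, Function.update_of_ne hij]
  simp only [cubeFourierCoeff_singleton]
  simp only [branch_eq G i, add_mul _ _ (((_ : ℤˣ) : ℤ) : ℝ), Finset.sum_add_distrib]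
  have h' : ∑ x : Cube n, (G 1 x - G (-1) x) / 2 * ((x i : ℤ) : ℝ) * ((x j : ℤ) : ℝ) = 0 := by
    rw [← h]
    exact Finset.sum_congr rfl fun x _ => by ring
  rw [h', add_zero, ← add_div, div_right_comm, ← Finset.sum_add_distrib]
  congr 1
  rw [Finset.sum_div]
  exact Finset.sum_congr rfl fun x _ => by ring

/-- The coefficient at `i` is half the difference of the two means; every other one is an average,
to which the triangle inequality applies. -/
theorem levelNorm_one_branch_le {G : ℤˣ → Cube n → ℝ} {i : Fin n}
    (hG : ∀ b, IgnoresCoord (G b) i) :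
    levelNorm 1 (fun x => G (x i) x) ≤
      |(cubeFourierCoeff (G 1) ∅ - cubeFourierCoeff (G (-1)) ∅) / 2| +
        (levelNorm 1 (G 1) + levelNorm 1 (G (-1))) / 2 := by
  simp only [levelNorm_one]
  rw [← Finset.add_sum_erase _ _ (Finset.mem_univ i), cubeFourierCoeff_branch_self hG]
  gcongr
  calc ∑ j ∈ Finset.univ.erase i, |cubeFourierCoeff (fun x => G (x i) x) {j}|
      ≤ ∑ j ∈ Finset.univ.erase i,
          (|cubeFourierCoeff (G 1) {j}| + |cubeFourierCoeff (G (-1)) {j}|) / 2 := by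
        refine Finset.sum_le_sum fun j hj => ?_
        rw [cubeFourierCoeff_branch_of_ne hG (Finset.ne_of_mem_erase hj), abs_div, abs_two]
        gcongr
        exact abs_add_le _ _
    _ ≤ ∑ j, (|cubeFourierCoeff (G 1) {j}| + |cubeFourierCoeff (G (-1)) {j}|) / 2 :=
        Finset.sum_le_sum_of_subset_of_nonneg (Finset.erase_subset _ _)
          fun j _ _ => by positivity
    _ = _ := by rw [← Finset.sum_div, Finset.sum_add_distrib]

/-- The level one norm of a `[-1, 1]`-valued function on `n` coordinates. -/
theorem levelNorm_one_le {g : Cube n → ℝ} (hg : ∀ x, |g x| ≤ 1) : levelNorm 1 g ≤ n := by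
  rw [levelNorm_one]
  have h : ∀ i, |cubeFourierCoeff g {i}| ≤ 1 := by
    intro i
    rw [cubeFourierCoeff_singleton, abs_div, abs_of_pos (by positivity : (0 : ℝ) < 2 ^ n),
      div_le_one (by positivity)]
    refine (Finset.abs_sum_le_sum_abs _ _).trans ?_
    refine (Finset.sum_le_card_nsmul _ _ 1 fun x _ => ?_).trans_eq (by simp)
    rw [abs_mul]
    obtain h | h := Int.units_eq_one_or (x i) <;> simpa [h] using hg x
  exact (Finset.sum_le_card_nsmul _ _ 1 fun i _ => h i).trans_eq (by simp)

/-! ### Total influence of monotone functions -/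

/-- The sum expands `∏ (1 + x_i y_i)`, which has a zero factor wherever `x` and `y` differ. -/
theorem sum_prod_mul_prod (x y : Cube n) :
    ∑ S : Finset (Fin n), (∏ i ∈ S, ((x i : ℤ) : ℝ)) * ∏ i ∈ S, ((y i : ℤ) : ℝ) =
      if x = y then 2 ^ n else 0 := by
  have h := Finset.prod_one_add (s := Finset.univ) (f := fun i => ((x i : ℤ) : ℝ) * ((y i : ℤ) : ℝ))
  rw [Finset.powerset_univ] at h
  simp only [← Finset.prod_mul_distrib]
  rw [← h]
  split_ifs with hxy
  · subst hxy
    simp only [coord_sq]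
    norm_num
  · obtain ⟨i, hi⟩ := Function.ne_iff.1 hxy
    refine Finset.prod_eq_zero (Finset.mem_univ i) ?_
    obtain h₁ | h₁ := Int.units_eq_one_or (x i) <;> obtain h₂ | h₂ := Int.units_eq_one_or (y i) <;>
      simp_all

/-- Parseval's identity on the cube. -/
theorem sum_cubeFourierCoeff_sq (g : Cube n → ℝ) :
    ∑ S, cubeFourierCoeff g S ^ 2 = (∑ x, g x ^ 2) / 2 ^ n := by
  have h : ∀ S : Finset (Fin n), cubeFourierCoeff g S ^ 2 =
      (∑ x : Cube n, ∑ y : Cube n, g x * g y *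
        ((∏ i ∈ S, ((x i : ℤ) : ℝ)) * ∏ i ∈ S, ((y i : ℤ) : ℝ))) / (2 ^ n * 2 ^ n) := by
    intro S
    rw [cubeFourierCoeff, sq, div_mul_div_comm, Finset.sum_mul_sum]
    congr 1
    exact Finset.sum_congr rfl fun x _ => Finset.sum_congr rfl fun y _ => by ring
  simp only [h]
  rw [← Finset.sum_div, Finset.sum_comm]
  have h' : ∀ x : Cube n, ∑ S : Finset (Fin n), ∑ y : Cube n, g x * g y *
      ((∏ i ∈ S, ((x i : ℤ) : ℝ)) * ∏ i ∈ S, ((y i : ℤ) : ℝ)) = g x ^ 2 * 2 ^ n := by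
    intro x
    rw [Finset.sum_comm]
    simp only [← Finset.mul_sum, sum_prod_mul_prod]
    simp [sq]
  simp only [h', ← Finset.sum_mul]
  exact mul_div_mul_right _ _ (by positivity)

/-- Flipping the coordinate `i` negates the character of `S` exactly when `i ∈ S`. -/
theorem cubeFourierCoeff_sub_flipCoord (g : Cube n → ℝ) (i : Fin n) (S : Finset (Fin n)) :
    cubeFourierCoeff (fun x => (g x - g (flipCoord i x)) / 2) S =
      if i ∈ S then cubeFourierCoeff g S else 0 := by
  have hprod : ∀ x : Cube n, ∏ j ∈ S, ((flipCoord i x j : ℤ) : ℝ) =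
      (if i ∈ S then -1 else 1) * ∏ j ∈ S, ((x j : ℤ) : ℝ) := by
    intro x
    split_ifs with hi
    · rw [← Finset.mul_prod_erase _ _ hi, ← Finset.mul_prod_erase S _ hi, neg_one_mul, ← neg_mul]
      congr 1
      · simp [flipCoord]
      · refine Finset.prod_congr rfl fun j hj => ?_
        rw [flipCoord, Function.update_of_ne (Finset.ne_of_mem_erase hj)]
    · rw [one_mul]
      refine Finset.prod_congr rfl fun j hj => ?_
      rw [flipCoord, Function.update_of_ne (ne_of_mem_of_not_mem hj hi)]
  have h := sum_flipCoord i fun x => g x * ∏ j ∈ S, ((flipCoord i x j : ℤ) : ℝ)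
  simp only [flipCoord_involutive i _, hprod] at h
  simp only [cubeFourierCoeff]
  have h' : ∑ x, (g x - g (flipCoord i x)) / 2 * ∏ j ∈ S, ((x j : ℤ) : ℝ) =
      ((∑ x, g x * ∏ j ∈ S, ((x j : ℤ) : ℝ)) -
        ∑ x, g (flipCoord i x) * ∏ j ∈ S, ((x j : ℤ) : ℝ)) / 2 := by
    rw [← Finset.sum_sub_distrib, Finset.sum_div]
    exact Finset.sum_congr rfl fun x _ => by ring
  rw [h', h]
  split_ifs
  · simp only [neg_one_mul, mul_neg, Finset.sum_neg_distrib]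
    ring
  · simp

/-- Parseval for each discrete derivative; a set `S` is counted once for each of its elements. -/
theorem totalInfluence_eq_sum (g : Cube n → ℝ) :
    totalInfluence g = ∑ i, (∑ x, ((g x - g (flipCoord i x)) / 2) ^ 2) / 2 ^ n := by
  simp only [← sum_cubeFourierCoeff_sq, cubeFourierCoeff_sub_flipCoord]
  rw [Finset.sum_comm, totalInfluence]
  refine Finset.sum_congr rfl fun S _ => ?_
  simp [ite_pow, Finset.sum_ite_mem]

/-- By monotonicity the derivative times `x i` lies in `{0, 1}`, hence equals the square of the
derivative. Its mean is both the coefficient and the influence. -/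
theorem totalInfluence_eq_levelNorm_one {f : Cube n → ℤˣ} (hf : Monotone f) :
    totalInfluence (realValued f) = levelNorm 1 (realValued f) := by
  rw [totalInfluence_eq_sum, levelNorm_one]
  refine Finset.sum_congr rfl fun i _ => ?_
  have hcoeff : cubeFourierCoeff (realValued f) {i} =
      (∑ x, ((realValued f x - realValued f (flipCoord i x)) / 2) ^ 2) / 2 ^ n := by
    have h := cubeFourierCoeff_sub_flipCoord (realValued f) i {i}
    rw [if_pos (Finset.mem_singleton_self i)] at h
    rw [← h, cubeFourierCoeff_singleton]
    congr 1
    refine Finset.sum_congr rfl fun x _ => ?_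
    obtain hx | hx := Int.units_eq_one_or (x i)
    · have hle : f (flipCoord i x) ≤ f x := by
        refine hf (update_le_self_iff.2 ?_)
        rw [hx]
        decide
      obtain h₁ | h₁ := Int.units_eq_one_or (f x) <;>
        obtain h₂ | h₂ := Int.units_eq_one_or (f (flipCoord i x)) <;>
        rw [h₁, h₂] at hle <;> first | exact absurd hle (by decide) | norm_num [realValued, h₁, h₂, hx]
    · have hle : f x ≤ f (flipCoord i x) := by
        refine hf (le_update_self_iff.2 ?_)
        rw [hx]
        decide
      obtain h₁ | h₁ := Int.units_eq_one_or (f x) <;>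
        obtain h₂ | h₂ := Int.units_eq_one_or (f (flipCoord i x)) <;>
        rw [h₁, h₂] at hle <;> first | exact absurd hle (by decide) | norm_num [realValued, h₁, h₂, hx]
  rw [← hcoeff, abs_of_nonneg]
  rw [hcoeff]
  positivity

end Fourier

/-! ### Read-once branching programs as walks -/

namespace BranchingProgram

variable {n w : ℕ} (B : BranchingProgram n w)

/-- The node reached on input `x` after `s` steps from the node `v` of layer `t`. -/
def nodeFrom (x : Cube n) : ℕ → ℕ → Fin w → Fin w
  | 0, _, v => v
  | s + 1, t, v => nodeFrom x s (t + 1) (B.next t v (x (B.query t v)))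

/-- The transitions of the `s` layers from layer `t` on. -/
def transitionsFrom : ℕ → ℕ → List (Transition (Fin w))
  | 0, _ => []
  | s + 1, t => (fun b v => B.next t v b) :: transitionsFrom s (t + 1)

/-- The variable `i` is queried within `s` steps from the node `v` of layer `t`. -/
def QueriesFrom (i : Fin n) : ℕ → ℕ → Fin w → Prop
  | 0, _, _ => False
  | s + 1, t, v => B.query t v = i ∨ ∃ b, QueriesFrom i s (t + 1) (B.next t v b)

theorem inputNode_add (x : Cube n) (s t : ℕ) :
    B.inputNode x (t + s) = B.nodeFrom x s t (B.inputNode x t) := by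
  induction s generalizing t with
  | zero => rfl
  | succ s ih =>
    rw [nodeFrom, ← Nat.succ_add_eq_add_succ, ih]
    rfl

theorem length_transitionsFrom (s t : ℕ) : (B.transitionsFrom s t).length = s := by
  induction s generalizing t with
  | zero => rfl
  | succ s ih => rw [transitionsFrom, List.length_cons, ih]

theorem nodeFrom_update {i : Fin n} {s t : ℕ} {v : Fin w} (h : ¬ B.QueriesFrom i s t v)
    (x : Cube n) (c : ℤˣ) : B.nodeFrom (Function.update x i c) s t v = B.nodeFrom x s t v := by
  induction s generalizing t v with
  | zero => rfl
  | succ s ih =>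
    simp only [QueriesFrom, not_or, not_exists] at h
    rw [nodeFrom, nodeFrom, Function.update_of_ne h.1, ih (h.2 _)]

theorem pathNode_congr {b b' : ℕ → ℤˣ} {t : ℕ} (h : ∀ s < t, b s = b' s) :
    B.pathNode b t = B.pathNode b' t := by
  induction t with
  | zero => rfl
  | succ t ih =>
    rw [pathNode, pathNode, ih fun s hs => h s (hs.trans t.lt_succ_self), h t t.lt_succ_self]

/-- Extends a path from the start node up to a later query, since read-onceness speaks only of such
paths. -/
theorem QueriesFrom.exists_path {i : Fin n} {s t : ℕ} {v : Fin w} (h : B.QueriesFrom i s t v)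
    {b : ℕ → ℤˣ} (hb : B.pathNode b t = v) :
    ∃ (b' : ℕ → ℤˣ) (u : ℕ), (∀ r < t, b' r = b r) ∧ t ≤ u ∧ u < t + s ∧
      B.query u (B.pathNode b' u) = i := by
  induction s generalizing t v b with
  | zero => exact h.elim
  | succ s ih =>
    obtain h | ⟨c, h⟩ := h
    · exact ⟨b, t, fun _ _ => rfl, le_rfl, by omega, by rw [hb, h]⟩
    · have hc : B.pathNode (Function.update b t c) (t + 1) = B.next t v c := by
        rw [pathNode, Function.update_self, ← hb]
        congr 1
        exact B.pathNode_congr fun r hr => Function.update_of_ne hr.ne _ _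
      obtain ⟨b', u, h₁, h₂, h₃, h₄⟩ := ih h hc
      refine ⟨b', u, fun r hr => ?_, by omega, by omega, h₄⟩
      rw [h₁ r (by omega), Function.update_of_ne hr.ne]

variable {B}

theorem IsReadOnce.not_queriesFrom (hB : B.IsReadOnce) {s t : ℕ} (hst : t + s < B.length)
    (b : ℕ → ℤˣ) (c : ℤˣ) :
    ¬ B.QueriesFrom (B.query t (B.pathNode b t)) s (t + 1) (B.next t (B.pathNode b t) c) := by
  intro h
  have hc : B.pathNode (Function.update b t c) (t + 1) = B.next t (B.pathNode b t) c := by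
    rw [pathNode, Function.update_self]
    congr 1
    exact B.pathNode_congr fun r hr => Function.update_of_ne hr.ne _ _
  obtain ⟨b', u, h₁, h₂, h₃, h₄⟩ := h.exists_path B hc
  refine hB b' t u (by omega) (by omega) ?_
  rw [h₄]
  congr 1
  refine B.pathNode_congr fun r hr => ?_
  rw [h₁ r (by omega), Function.update_of_ne hr.ne]

/-- No path reads more than `n` variables. -/
theorem IsReadOnce.length_le (hB : B.IsReadOnce) : B.length ≤ n := by
  have hinj : Function.Injective fun t : Fin B.length =>
      B.query t (B.pathNode (fun _ => 1) t) := by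
    intro s t hst
    by_contra hne
    rcases lt_or_gt_of_ne hne with h | h
    · exact hB _ s t h t.2 hst
    · exact hB _ t s h s.2 hst.symm
  simpa using Fintype.card_le_of_injective _ hinj

/-- Only at nodes on a path from the start are both branches known to ignore the queried variable;
this is why the node is given as `B.pathNode b t`. -/
theorem IsReadOnce.fourier_nodeFrom (hB : B.IsReadOnce) (φ : Fin w → ℝ) {s t : ℕ}
    (hst : t + s ≤ B.length) (b : ℕ → ℤˣ) :
    cubeFourierCoeff (fun x => φ (B.nodeFrom x s t (B.pathNode b t))) ∅ =
        expectedOutput φ (B.transitionsFrom s t) (B.pathNode b t) ∧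
      levelNorm 1 (fun x => φ (B.nodeFrom x s t (B.pathNode b t))) ≤
        expectedVariation φ (B.transitionsFrom s t) (B.pathNode b t) := by
  induction s generalizing t b with
  | zero =>
    refine ⟨?_, ?_⟩
    · simp [cubeFourierCoeff_empty, nodeFrom, transitionsFrom, expectedOutput]
    · rw [levelNorm_one]
      refine (Finset.sum_eq_zero fun i _ => ?_).le
      rw [cubeFourierCoeff_singleton, sum_mul_coord_eq_zero (fun _ _ => rfl), zero_div, abs_zero]
  | succ s ih =>
    set v := B.pathNode b t with hv
    have hstep : ∀ c, B.next t v c = B.pathNode (Function.update b t c) (t + 1) := by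
      intro c
      rw [pathNode, Function.update_self, hv]
      congr 1
      exact B.pathNode_congr fun r hr => (Function.update_of_ne hr.ne _ _).symm
    have hG : ∀ c, IgnoresCoord (fun x => φ (B.nodeFrom x s (t + 1) (B.next t v c)))
        (B.query t v) := fun c x d => by
      simp only [B.nodeFrom_update (hB.not_queriesFrom (s := s) (t := t) (by omega) b c), hv]
    have h₁ := ih (t := t + 1) (by omega) (Function.update b t 1)
    have h₂ := ih (t := t + 1) (by omega) (Function.update b t (-1))
    rw [← hstep] at h₁ h₂
    refine ⟨?_, ?_⟩
    · refine (cubeFourierCoeff_branch_empty hG).trans ?_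
      rw [h₁.1, h₂.1]
      rfl
    · refine (levelNorm_one_branch_le hG).trans ?_
      rw [h₁.1, h₂.1, transitionsFrom, expectedVariation]
      linarith [h₁.2, h₂.2]

end BranchingProgram

/-! ### Choice of parameters and conclusion -/

theorem levelNorm_one_le_of_computableByROBP {n M w : ℕ} (hM : n ^ 2 ≤ 2 ^ M) {f : Cube n → ℤˣ}
    (hf : ComputableByROBP (w + 2) f) :
    levelNorm 1 (realValued f) ≤ 5 * (M + 2 : ℝ) ^ w - 3 := by
  obtain ⟨B, hB, hBf⟩ := hf
  have h := (hB.fourier_nodeFrom (fun v => ((B.output v : ℤ) : ℝ)) (t := 0) (s := B.length)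
    (by omega) fun _ => 1).2
  have heq : (fun x => ((B.output (B.nodeFrom x B.length 0 (B.pathNode (fun _ => 1) 0)) : ℤ) : ℝ)) =
      realValued f := by
    funext x
    rw [realValued, ← hBf, BranchingProgram.eval]
    have := B.inputNode_add x B.length 0
    rw [Nat.zero_add] at this
    rw [this]
    rfl
  rw [heq] at h
  refine h.trans (expectedVariation_le hM w _ ?_ _ (fun v => ?_) _)
  · rw [B.length_transitionsFrom]
    exact hB.length_le
  · obtain h | h := Int.units_eq_one_or (B.output v) <;> simp [h]

theorem exists_log_bound : ∃ K : ℝ, 1 ≤ K ∧ ∀ n : ℕ, 2 ≤ n → ∃ M : ℕ,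
    n ^ 2 ≤ 2 ^ M ∧ (M + 2 : ℝ) ≤ K * Real.log n := by
  have hlog2 : 0 < Real.log 2 := Real.log_pos one_lt_two
  -- For `c = Nat.clog 2 n`, `2 ^ (c - 1) ≤ n` gives `(2c + 2) log 2 = 2(c - 1) log 2 + 4 log 2 ≤ 6
  -- log n`.
  refine ⟨max 1 (6 / Real.log 2), le_max_left _ _, fun n hn => ⟨2 * Nat.clog 2 n, ?_, ?_⟩⟩
  · rw [pow_mul', sq, sq]
    have := Nat.le_pow_clog one_lt_two n
    gcongr
  · have hlogn : Real.log 2 ≤ Real.log n := Real.log_le_log two_pos (by exact_mod_cast hn)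
    have hclog : (2 : ℝ) ^ (Nat.clog 2 n - 1) ≤ n := by
      exact_mod_cast (Nat.pow_pred_clog_lt_self one_lt_two (by omega)).le
    have hpos : 1 ≤ Nat.clog 2 n := Nat.clog_pos one_lt_two hn
    have h := Real.log_le_log (by positivity) hclog
    rw [Real.log_pow, Nat.cast_sub hpos, Nat.cast_one] at h
    have hle : (2 * Nat.clog 2 n + 2 : ℝ) ≤ 6 / Real.log 2 * Real.log n := by
      rw [div_mul_eq_mul_div, le_div_iff₀ hlog2]
      linarith
    push_cast
    refine hle.trans ?_
    gcongr
    exact le_max_right _ _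

theorem mainTheorem4 :
    ∃ C₀ : ℝ, 0 < C₀ ∧ ∀ w : ℕ, 2 ≤ w → ∃ C : ℝ, 0 < C ∧
      ∀ (n : ℕ), 1 ≤ n → ∀ f : Cube n → ℤˣ, ComputableByROBP w f →
        levelNorm 1 (realValued f) ≤ (C * Real.log n) ^ (w - 2) + C₀ ∧
        (Monotone f →
          totalInfluence (realValued f) = levelNorm 1 (realValued f) ∧
          totalInfluence (realValued f) ≤ (C * Real.log n) ^ (w - 2) + C₀) := by
  obtain ⟨K, hK, hlog⟩ := exists_log_bound
  refine ⟨2, two_pos, fun w hw => ?_⟩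
  obtain ⟨w, rfl⟩ := Nat.exists_eq_add_of_le' hw
  refine ⟨5 * K, by positivity, fun n hn f hf => ?_⟩
  suffices h : levelNorm 1 (realValued f) ≤ (5 * K * Real.log n) ^ (w + 2 - 2) + 2 from
    ⟨h, fun hmono => ⟨totalInfluence_eq_levelNorm_one hmono,
      (totalInfluence_eq_levelNorm_one hmono).trans_le h⟩⟩
  rw [Nat.add_sub_cancel]
  have hnonneg : 0 ≤ (5 * K * Real.log n) ^ w := by
    have := Real.log_natCast_nonneg n
    positivity
  obtain rfl | hn := hn.eq_or_lt
  -- Here `log n = 0`, so the trivial bound by the number of variables is used.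
  · have h : levelNorm 1 (realValued f) ≤ (1 : ℕ) := levelNorm_one_le fun x => by
      obtain h | h := Int.units_eq_one_or (f x) <;> simp [realValued, h]
    rw [Nat.cast_one] at h
    linarith
  · obtain ⟨M, hM, hMK⟩ := hlog n hn
    have h := levelNorm_one_le_of_computableByROBP hM hf
    -- A zeroth power cannot absorb the factor 5, but then the bound is `5 - 3 = 2`.
    obtain rfl | hw := Nat.eq_zero_or_pos w
    · simp only [pow_zero] at h ⊢
      linarith
    · have h₁ : 5 * (M + 2 : ℝ) ^ w ≤ (5 * K * Real.log n) ^ w := by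
        calc 5 * (M + 2 : ℝ) ^ w ≤ 5 ^ w * (M + 2 : ℝ) ^ w := by
              gcongr
              exact le_self_pow₀ (by norm_num) hw.ne'
          _ = (5 * (M + 2 : ℝ)) ^ w := (mul_pow _ _ _).symm
          _ ≤ (5 * K * Real.log n) ^ w := by
              rw [mul_assoc]
              gcongr
      linarith
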